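/- Let $p\ge 1$ and let $\sigma:\mathbb{R}\to\mathbb{R}$ be $p$-homogeneous, i.e. $\sigma(\alpha t)=\alpha^p\sigma(t)$ for all $t\in\mathbb{R}$ and $\alpha\ge 0$, with $\sigma(0)=0$ and $|\sigma(t)|\le L_\sigma|t|^p$ for all $t\in\mathbb{R}$, for some constant $L_\sigma<\infty$. Let $\gamma\sim\mathcal N(0,1)$, put $m_1:=|\mathbb{E}[\sigma(\gamma)]|$ and $m_2:=\mathbb{E}[\sigma(\gamma)^2]$, and assume $m_1>0$. Then there exists a constant $c>0$, depending only on $p,\sigma(1),\sigma(-1),m_1$, such that the following holds for all $0<\varepsilon_1\le 1$ and $0<\varepsilon_2<1$, all depths $L$, all widths $d_0,\dots,d_L$, all $n$, and every fixed data matrix $X\in\mathbb{R}^{d_0\times n}$. Let $W_\ell\in\mathbb{R}^{d_\ell\times d_{\ell-1}}$, $\ell=1,\dots,L$, be independent random matrices, where $W_\ell$ has i.i.d. $\mathcal N(0,1/d_{\ell-1})$ entries, and define $A_0=X$ and $A_\ell=\sigma(W_\ell A_{\ell-1})$ for $\ell=1,\dots,L$, with $\sigma$ applied entrywise. Let $\mathrm{st}(A)=\|A\|_F^2/\|A\|_{\mathrm{op}}^2$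 denote the stable rank (with $\mathrm{st}(0):=0$). Then with probability at least \[ 1-\sum_{\ell=1}^L\Big(2\exp\big(-c\min\{d_\ell\varepsilon_2^2,\ d_\ell^{\min(1,2/p)}\varepsilon_2^{2/p}\}\big)+2\exp\big(-c\min\{d_\ell\varepsilon_1^2,\ d_\ell^{\min(1,1/p)}\varepsilon_1^{1/p}\}\big)\Big), \] simultaneously for every $\ell=1,\dots,L$, \[ \mathrm{st}(A_\ell)\le\frac{1+\varepsilon_1}{(1-\varepsilon_2)^2}\cdot\frac{m_2}{m_1^2}, \] and moreover $A_\ell\ne 0$ if $X\neq 0$ (so that $\mathrm{st}(A_\ell)$ is a genuine quotient). -/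

import Mathlib

open MeasureTheory ProbabilityTheory
open scoped NNReal

noncomputable section

/-- The Frobenius norm of a real matrix. -/
def frobNorm {m n : ℕ} (A : Matrix (Fin m) (Fin n) ℝ) : ℝ :=
  @norm _ Matrix.frobeniusNormedAddCommGroup.toNorm A

/-- The operator norm of a real matrix, as a map between Euclidean spaces. -/
def opNorm {m n : ℕ} (A : Matrix (Fin m) (Fin n) ℝ) : ℝ :=
  @norm _ Matrix.instL2OpNormedAddCommGroup.toNorm A

/-- The stable rank `‖A‖_F² / ‖A‖_op²` (with value `0` at the zero matrix). -/
def stableRank {m n : ℕ} (A : Matrix (Fin m) (Fin n) ℝ) : ℝ :=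
  frobNorm A ^ 2 / opNorm A ^ 2

/-- `σ(α t) = α ^ p σ(t)` for all real `t` and all `α ≥ 0`. -/
def IsPosHomogeneous (p : ℝ) (σ : ℝ → ℝ) : Prop :=
  ∀ α t : ℝ, 0 ≤ α → σ (α * t) = α ^ p * σ t

/-- Post-activation matrices of a bias-free MLP: `A_0 = X` and `A_{ℓ+1} = σ(W_{ℓ+1} A_ℓ)`,
with `σ` applied entrywise. The weight matrix `W_{ℓ+1}` has index `ℓ : Fin L`. -/
def postActivation {L : ℕ} {d : Fin (L + 1) → ℕ} {n : ℕ} (σ : ℝ → ℝ)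
    (W : (ℓ : Fin L) → Matrix (Fin (d ℓ.succ)) (Fin (d ℓ.castSucc)) ℝ)
    (X : Matrix (Fin (d 0)) (Fin n) ℝ) (ℓ : Fin (L + 1)) : Matrix (Fin (d ℓ)) (Fin n) ℝ :=
  Fin.induction (motive := fun k => Matrix (Fin (d k)) (Fin n) ℝ) X
    (fun k A => (W k * A).map σ) ℓ

/-- Gaussian initialization: all entries of all weight matrices are jointly independent, and the
entries of `W_{ℓ+1}`, a matrix of size `d_{ℓ+1} × d_ℓ`, have law `N(0, 1/d_ℓ)`. -/
structure IsGaussianInit {Ω : Type*} [MeasurableSpace Ω] (μ : Measure Ω) {L : ℕ}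
    {d : Fin (L + 1) → ℕ}
    (W : (ℓ : Fin L) → Ω → Matrix (Fin (d ℓ.succ)) (Fin (d ℓ.castSucc)) ℝ) : Prop where
  measurable : ∀ ℓ i j, Measurable fun ω => W ℓ ω i j
  law : ∀ ℓ i j, μ.map (fun ω => W ℓ ω i j) = gaussianReal 0 ((d ℓ.castSucc : ℝ≥0)⁻¹)
  indep : iIndepFun
    (fun (k : (ℓ : Fin L) × (Fin (d ℓ.succ) × Fin (d ℓ.castSucc))) (ω : Ω) =>
      W k.1 ω k.2.1 k.2.2) μ

end

/-! ### Elementary inequalities -/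

/-! Fix the input `a` of a layer with `N` output rows, and let `u j = colScale p a j`. By
homogeneity the `(i, j)` entry of the output is `u j * σ (γ i j)` with `γ i j` standard Gaussian. So
the output has rank-one mean, `E[σ(γ)]` times `1 ⊗ u`, with squared operator norm `N * m₁ ^ 2 * ‖u‖
^ 2`, while its expected squared Frobenius norm is `N * m₂ * ‖u‖ ^ 2`. The ratio is `m₂ / m₁ ^ 2`.
It remains to show that the Frobenius norm is not much above its mean, and that the pairing with `1
⊗ u`, which bounds the operator norm from below, is not much below its mean.

Both quantities are sums over the independent rows of averages with weights `u j ^ 2 / ‖u‖ ^ 2`.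
Entries within a row may be arbitrarily correlated, so no independence is available across columns.
A Jensen inequality (`exp_rpow_sum_le`) shows that such an average has the same
stretched-exponential moments as a single term, up to constants free of `n` and of the weights. A
Bernstein inequality for tails `exp (-κ t ^ α)` (`exists_measureReal_sum_ge_le`) then applies: `σ ^
2` has growth degree `2 * p`, giving `α = 1 / p`, and `σ` has degree `p`, giving `α = min 1 (2 /
p)`.

Since the bound holds uniformly in `a`, and the input of a layer is independent of its weights, it
carries over to the random input. A union bound over layers finishes the proof. -/

lemma exp_le_one_add_add_sq_mul_exp (x : ℝ) :
    Real.exp x ≤ 1 + x + x ^ 2 * Real.exp (max x 0) := by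
  rcases le_total 0 x with hx | hx
  · rw [max_eq_left hx]
    have h1 : Real.exp x - 1 ≤ x * Real.exp x := by
      have h := Real.add_one_le_exp (-x)
      have h2 : Real.exp (-x) * Real.exp x = 1 := by rw [← Real.exp_add]; simp
      nlinarith [Real.exp_pos x]
    nlinarith [mul_le_mul_of_nonneg_left h1 hx]
  · rw [max_eq_right hx, Real.exp_zero, mul_one]
    rcases le_total (-1) x with h | h
    · have := Real.abs_exp_sub_one_sub_id_le (x := x) (abs_le.2 ⟨h, by linarith⟩)
      linarith [(abs_le.1 this).2]
    · have : Real.exp x ≤ 1 := Real.exp_le_one_iff.2 hx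
      nlinarith

lemma rpow_le_exp_mul {s κ u : ℝ} (hs : 0 < s) (hκ : 0 < κ) (hu : 0 ≤ u) :
    u ^ s ≤ (s / κ) ^ s * Real.exp (κ * u) := by
  have h1 : κ * u / s ≤ Real.exp (κ * u / s) := by linarith [Real.add_one_le_exp (κ * u / s)]
  have h2 : u ≤ s / κ * Real.exp (κ * u / s) := by
    calc u = s / κ * (κ * u / s) := by field_simp
      _ ≤ _ := by gcongr
  calc u ^ s ≤ (s / κ * Real.exp (κ * u / s)) ^ s := by gcongr
    _ = (s / κ) ^ s * Real.exp (κ * u) := by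
      rw [Real.mul_rpow (by positivity) (by positivity), ← Real.exp_mul]
      congr 2; field_simp

/-- The function `x ↦ exp (κ x ^ (1 / q))` lies above its tangent at `v ^ q`,
provided `κ v ≥ q`; here `x = u ^ q`. -/
lemma one_add_mul_rpow_sub_one_le_exp {q A s : ℝ} (hq : 0 < q) (hA : q ≤ A) (hs : 0 ≤ s) :
    1 + A / q * (s ^ q - 1) ≤ Real.exp (A * (s - 1)) := by
  have h1 : s ^ q ≤ Real.exp (q * (s - 1)) := by
    calc s ^ q ≤ (Real.exp (s - 1)) ^ q := by
          gcongr; linarith [Real.add_one_le_exp (s - 1)]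
      _ = _ := by rw [← Real.exp_mul, mul_comm]
  have hr : 1 ≤ A / q := (one_le_div hq).2 hA
  -- Bernoulli's inequality with exponent `A / q ≥ 1`; this is where `q ≤ A` enters.
  have h2 := one_add_mul_self_le_rpow_one_add (s := Real.exp (q * (s - 1)) - 1)
    (by linarith [Real.exp_pos (q * (s - 1))]) hr
  rw [add_sub_cancel, ← Real.exp_mul] at h2
  have h3 : q * (s - 1) * (A / q) = A * (s - 1) := by field_simp
  rw [h3] at h2
  nlinarith

/-- Jensen's inequality for `x ↦ exp (κ x ^ (1 / q))`, up to an additive constant that makes up for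
the lack of convexity near `0`. -/
lemma exp_rpow_sum_le {ι : Type*} [Fintype ι] {q κ : ℝ} (hq : 0 < q) (hκ : 0 < κ)
    (w z : ι → ℝ) (hw : ∀ j, 0 ≤ w j) (hw1 : ∑ j, w j = 1) (hz : ∀ j, 0 ≤ z j) :
    Real.exp (κ * (∑ j, w j * z j) ^ (1 / q)) ≤
      Real.exp q + ∑ j, w j * Real.exp (κ * z j ^ (1 / q)) := by
  set y := ∑ j, w j * z j with hy
  have hy0 : 0 ≤ y := Finset.sum_nonneg fun j _ => mul_nonneg (hw j) (hz j)
  -- Below the threshold the additive constant `exp q` suffices. Above it, the tangent at `y`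
  -- supports the function from below, and averaging the tangent gives its value at `y`.
  rcases le_total (κ * y ^ (1 / q)) q with h | h
  · have h1 : 0 ≤ ∑ j, w j * Real.exp (κ * z j ^ (1 / q)) :=
      Finset.sum_nonneg fun j _ => mul_nonneg (hw j) (Real.exp_pos _).le
    linarith [Real.exp_le_exp.2 h]
  · have hypos : 0 < y := by
      rcases hy0.eq_or_lt with h0 | h0
      · rw [← h0, Real.zero_rpow (by positivity)] at h; linarith
      · exact h0
    set v := y ^ (1 / q) with hv
    have hvpos : 0 < v := Real.rpow_pos_of_pos hypos _
    have hvq : v ^ q = y := by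
      rw [hv, ← Real.rpow_mul hy0, one_div, inv_mul_cancel₀ hq.ne', Real.rpow_one]
    have key : ∀ j, Real.exp (κ * v) * (1 + κ * v / q * (z j / y - 1)) ≤
        Real.exp (κ * z j ^ (1 / q)) := by
      intro j
      have h1 := one_add_mul_rpow_sub_one_le_exp (s := z j ^ (1 / q) / v) hq h
        (div_nonneg (Real.rpow_nonneg (hz j) _) hvpos.le)
      rw [Real.div_rpow (Real.rpow_nonneg (hz j) _) hvpos.le, hvq, ← Real.rpow_mul (hz j),
        one_div, inv_mul_cancel₀ hq.ne', Real.rpow_one, ← one_div] at h1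
      calc _ ≤ Real.exp (κ * v) * Real.exp (κ * v * (z j ^ (1 / q) / v - 1)) := by gcongr
        _ = _ := by rw [← Real.exp_add]; congr 1; field_simp; ring
    have h2 : ∑ j, w j * (Real.exp (κ * v) * (1 + κ * v / q * (z j / y - 1))) =
        Real.exp (κ * v) := by
      have : ∀ j, w j * (Real.exp (κ * v) * (1 + κ * v / q * (z j / y - 1))) =
          Real.exp (κ * v) * (1 - κ * v / q) * w j +
            Real.exp (κ * v) * (κ * v / q) / y * (w j * z j) := fun j => by ring
      simp_rw [this]
      rw [Finset.sum_add_distrib, ← Finset.mul_sum, ← Finset.mul_sum, hw1, ← hy]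
      field_simp
      ring
    have h3 : Real.exp (κ * v) ≤ ∑ j, w j * Real.exp (κ * z j ^ (1 / q)) := by
      rw [← h2]
      exact Finset.sum_le_sum fun j _ => mul_le_mul_of_nonneg_left (key j) (hw j)
    linarith [Real.exp_pos q]

/-! ### Concentration for sums of variables with stretched-exponential tails -/

/-- Moment generating function of a variable truncated from above at level `t`. -/
lemma mgf_truncation_le {Ω : Type*} [MeasurableSpace Ω] {μ : Measure Ω} [IsProbabilityMeasure μ]
    {α κ K C l t : ℝ} {ξ : Ω → ℝ} (hα : 0 < α) (hα1 : α ≤ 1) (hm : Measurable ξ)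
    (hint : Integrable ξ μ) (h0 : ∫ ω, ξ ω ∂μ = 0)
    (hexp : Integrable (fun ω => Real.exp (κ * |ξ ω| ^ α)) μ)
    (hK : ∫ ω, Real.exp (κ * |ξ ω| ^ α) ∂μ ≤ K)
    (hC : ∀ u : ℝ, 0 ≤ u → u ^ 2 ≤ C * Real.exp (κ / 2 * u ^ α))
    (hC0 : 0 ≤ C) (ht : 0 < t) (hl : 0 ≤ l) (hlt : l * t ^ (1 - α) ≤ κ / 2) :
    Integrable (fun ω => Real.exp (l * (if ξ ω ≤ t then ξ ω else 0))) μ ∧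
      mgf (fun ω => if ξ ω ≤ t then ξ ω else 0) μ l ≤ Real.exp (l ^ 2 * (C * K)) := by
  have hκ : 0 ≤ κ / 2 := le_trans (by positivity) hlt
  have hpt : ∀ ω, Real.exp (l * (if ξ ω ≤ t then ξ ω else 0)) ≤
      1 + l * ξ ω + l ^ 2 * C * Real.exp (κ * |ξ ω| ^ α) := by
    intro ω
    set x := ξ ω
    have hpos : 0 ≤ l ^ 2 * C * Real.exp (κ * |x| ^ α) := by positivity
    split_ifs with hx
    · have h1 := exp_le_one_add_add_sq_mul_exp (l * x)
      -- The purpose of truncating: for `0 < x ≤ t`, `l * x = l * x ^ (1 - α) * x ^ α`, so the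
      -- linear exponent is dominated by half of the available one. The other half pays for `x ^ 2`.
      have h2 : max (l * x) 0 ≤ κ / 2 * |x| ^ α := by
        refine max_le ?_ (by positivity)
        rcases le_total x 0 with hx0 | hx0
        · exact (mul_nonpos_of_nonneg_of_nonpos hl hx0).trans (by positivity)
        · rw [abs_of_nonneg hx0]
          rcases hx0.eq_or_lt with h | h
          · rw [← h, Real.zero_rpow hα.ne']; simp
          · have h3 : x = x ^ (1 - α) * x ^ α := by
              rw [← Real.rpow_add h]; simp
            calc l * x = l * x ^ (1 - α) * x ^ α := by rw [mul_assoc, ← h3]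
              _ ≤ l * t ^ (1 - α) * x ^ α := by gcongr
              _ ≤ _ := by gcongr
      have h4 := hC |x| (abs_nonneg x)
      rw [sq_abs] at h4
      have h5 : (l * x) ^ 2 * Real.exp (max (l * x) 0) ≤
          l ^ 2 * C * Real.exp (κ * |x| ^ α) := by
        calc (l * x) ^ 2 * Real.exp (max (l * x) 0)
            ≤ l ^ 2 * (C * Real.exp (κ / 2 * |x| ^ α)) * Real.exp (κ / 2 * |x| ^ α) := by
              rw [mul_pow]; gcongr
          _ = l ^ 2 * C * (Real.exp (κ / 2 * |x| ^ α) * Real.exp (κ / 2 * |x| ^ α)) := by ring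
          _ = _ := by rw [← Real.exp_add]; congr 2; ring
      linarith
    · rw [mul_zero, Real.exp_zero]
      have : 0 ≤ l * x := mul_nonneg hl (by linarith)
      linarith
  have hmeas : Measurable fun ω => if ξ ω ≤ t then ξ ω else 0 :=
    Measurable.ite (measurableSet_le hm measurable_const) hm measurable_const
  have hdom : Integrable (fun ω => 1 + l * ξ ω + l ^ 2 * C * Real.exp (κ * |ξ ω| ^ α)) μ :=
    ((integrable_const 1).add (hint.const_mul l)).add (hexp.const_mul _)
  have hi : Integrable (fun ω => Real.exp (l * (if ξ ω ≤ t then ξ ω else 0))) μ := by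
    refine hdom.mono' (hmeas.const_mul l).exp.aestronglyMeasurable (ae_of_all _ fun ω => ?_)
    rw [Real.norm_of_nonneg (Real.exp_pos _).le]
    exact hpt ω
  refine ⟨hi, ?_⟩
  calc mgf (fun ω => if ξ ω ≤ t then ξ ω else 0) μ l
      ≤ ∫ ω, (1 + l * ξ ω + l ^ 2 * C * Real.exp (κ * |ξ ω| ^ α)) ∂μ :=
        integral_mono hi hdom hpt
    _ = 1 + l ^ 2 * C * ∫ ω, Real.exp (κ * |ξ ω| ^ α) ∂μ := by
        have hadd : Integrable (fun ω => 1 + l * ξ ω) μ :=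
          (integrable_const 1).add (hint.const_mul l)
        rw [integral_add hadd (hexp.const_mul _),
          integral_add (integrable_const 1) (hint.const_mul l), integral_const_mul,
          integral_const_mul, h0]
        simp
    _ ≤ l ^ 2 * (C * K) + 1 := by
        have := mul_le_mul_of_nonneg_left hK (by positivity : 0 ≤ l ^ 2 * C)
        linarith
    _ ≤ _ := Real.add_one_le_exp _

/-- Chernoff bound for a sum of independent variables truncated from above at level `t`. -/
lemma measureReal_truncation_sum_ge_le {Ω : Type*} [MeasurableSpace Ω] {μ : Measure Ω}
    [IsProbabilityMeasure μ] {α κ K C a t : ℝ} {N : ℕ} {ξ : Fin N → Ω → ℝ}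
    (hα : 0 < α) (hα1 : α ≤ 1) (hm : ∀ i, Measurable (ξ i)) (hind : iIndepFun ξ μ)
    (hint : ∀ i, Integrable (ξ i) μ) (h0 : ∀ i, ∫ ω, ξ i ω ∂μ = 0)
    (hexp : ∀ i, Integrable (fun ω => Real.exp (κ * |ξ i ω| ^ α)) μ)
    (hK : ∀ i, ∫ ω, Real.exp (κ * |ξ i ω| ^ α) ∂μ ≤ K)
    (hC : ∀ u : ℝ, 0 ≤ u → u ^ 2 ≤ C * Real.exp (κ / 2 * u ^ α))
    (hC0 : 0 ≤ C) (ha : 0 ≤ a) (haκ : a ≤ κ / 2) (haC : a * (C * K) ≤ 1 / 2)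
    (ht : 0 < t) (hN : 0 < N) :
    μ.real {ω | t ≤ ∑ i, if ξ i ω ≤ t then ξ i ω else 0} ≤
      Real.exp (-(a / 2) * min (t ^ 2 / N) (t ^ α)) := by
  have hN' : (0 : ℝ) < N := by exact_mod_cast hN
  set M := min (t ^ 2 / N) (t ^ α) with hM
  have hM0 : 0 ≤ M := le_min (by positivity) (by positivity)
  -- Chernoff parameter. `M ≤ t ^ α` makes it admissible for the truncated moment bound, and `M ≤ t
  -- ^ 2 / N` keeps the quadratic term below half of `l * t = a * M`.
  set l := a * M / t with hldef
  have hl : 0 ≤ l := by positivity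
  have hlt : l * t ^ (1 - α) ≤ κ / 2 := by
    have h1 : M ≤ t ^ α := min_le_right _ _
    have h2 : t ^ α * t ^ (1 - α) = t := by rw [← Real.rpow_add ht]; simp
    calc l * t ^ (1 - α) = a / t * (M * t ^ (1 - α)) := by rw [hldef]; ring
      _ ≤ a / t * (t ^ α * t ^ (1 - α)) := by gcongr
      _ = a := by rw [h2]; field_simp
      _ ≤ _ := haκ
  set η : Fin N → Ω → ℝ := fun i ω => if ξ i ω ≤ t then ξ i ω else 0 with hη
  have hg : Measurable fun x : ℝ => if x ≤ t then x else 0 :=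
    Measurable.ite measurableSet_Iic measurable_id measurable_const
  have hηm : ∀ i, Measurable (η i) := fun i => hg.comp (hm i)
  have hηind : iIndepFun η μ := hind.comp (fun _ x => if x ≤ t then x else 0) fun _ => hg
  have hmgf := fun i => mgf_truncation_le (μ := μ) (ξ := ξ i) hα hα1 (hm i) (hint i) (h0 i)
    (hexp i) (hK i) hC hC0 ht hl hlt
  have hsumint : Integrable (fun ω => Real.exp (l * (∑ i, η i) ω)) μ :=
    hηind.integrable_exp_mul_sum hηm (s := Finset.univ) fun i _ => (hmgf i).1
  have hch := measure_ge_le_exp_mul_mgf (μ := μ) (X := ∑ i, η i) t hl hsumint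
  have hset : {ω | t ≤ (∑ i, η i) ω} = {ω | t ≤ ∑ i, if ξ i ω ≤ t then ξ i ω else 0} := by
    ext ω; simp [hη]
  rw [hset, hηind.mgf_sum hηm] at hch
  refine hch.trans ?_
  calc Real.exp (-l * t) * ∏ i, mgf (η i) μ l
      ≤ Real.exp (-l * t) * ∏ _i : Fin N, Real.exp (l ^ 2 * (C * K)) := by
        gcongr with i
        · exact fun i _ => mgf_nonneg
        · exact (hmgf i).2
    _ = Real.exp (-l * t + N * (l ^ 2 * (C * K))) := by
        rw [Finset.prod_const, ← Real.exp_nat_mul, Finset.card_univ, Fintype.card_fin,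
          ← Real.exp_add]
    _ ≤ _ := by
        rw [Real.exp_le_exp]
        have h1 : M * N ≤ t ^ 2 := by
          have := min_le_left (t ^ 2 / N) (t ^ α)
          rwa [← hM, le_div_iff₀ hN'] at this
        have h2 : l * t = a * M := by rw [hldef]; field_simp
        have h3 : N * (l ^ 2 * (C * K)) ≤ a * M / 2 := by
          have : N * (l ^ 2 * (C * K)) = (a * (C * K)) * (M * N / t ^ 2) * (a * M) := by
            rw [hldef]; field_simp
          rw [this]
          have h5 : M * N / t ^ 2 ≤ 1 := (div_le_one (by positivity)).2 h1
          have h6 : a * (C * K) * (M * N / t ^ 2) ≤ 1 / 2 * 1 := by gcongr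
          have h7 : 0 ≤ a * M := by positivity
          nlinarith
        linarith

/-- Bernstein-type inequality for independent centred variables with tails `exp (-κ t ^ α)`,
`α ≤ 1`. -/
theorem exists_measureReal_sum_ge_le.{u} (α κ K : ℝ) (hα : 0 < α) (hα1 : α ≤ 1) (hκ : 0 < κ) :
    ∃ c : ℝ, 0 < c ∧ ∀ (Ω : Type u) [MeasurableSpace Ω] (μ : Measure Ω) [IsProbabilityMeasure μ]
      (N : ℕ) (ξ : Fin N → Ω → ℝ), (∀ i, Measurable (ξ i)) → iIndepFun ξ μ →
      (∀ i, Integrable (ξ i) μ) → (∀ i, ∫ ω, ξ i ω ∂μ = 0) →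
      (∀ i, Integrable (fun ω => Real.exp (κ * |ξ i ω| ^ α)) μ) →
      (∀ i, ∫ ω, Real.exp (κ * |ξ i ω| ^ α) ∂μ ≤ K) →
      ∀ ε : ℝ, 0 < ε →
        μ.real {ω | N * ε ≤ ∑ i, ξ i ω} ≤
          2 * Real.exp (-c * min (N * ε ^ 2) ((N * ε) ^ α)) := by
  set C : ℝ := (2 / α / (κ / 2)) ^ (2 / α) with hCdef
  have hC0 : 0 < C := by positivity
  have hC : ∀ u : ℝ, 0 ≤ u → u ^ 2 ≤ C * Real.exp (κ / 2 * u ^ α) := by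
    intro u hu
    have h := rpow_le_exp_mul (s := 2 / α) (κ := κ / 2) (u := u ^ α) (by positivity)
      (by positivity) (by positivity)
    rw [← Real.rpow_mul hu, mul_div_cancel₀ _ hα.ne', Real.rpow_two] at h
    exact h
  set K' := max K 1 with hK'
  have hK'1 : 1 ≤ K' := le_max_right _ _
  set a := min (κ / 2) (1 / (2 * (C * K'))) with ha
  have ha0 : 0 < a := by positivity
  have haC : a * (C * K') ≤ 1 / 2 := by
    calc a * (C * K') ≤ 1 / (2 * (C * K')) * (C * K') := by gcongr; exact min_le_right _ _
      _ = 1 / 2 := by field_simp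
  have hlog : 0 < Real.log 2 := Real.log_pos (by norm_num)
  refine ⟨min (min (a / 2) (κ / 2)) (Real.log 2 / (C * K')), by positivity, ?_⟩
  intro Ω _ μ _ N ξ hm hind hint h0 hexp hK ε hε
  set c := min (min (a / 2) (κ / 2)) (Real.log 2 / (C * K')) with hc
  have hc0 : 0 < c := by positivity
  have hca : c ≤ a / 2 := (min_le_left _ _).trans (min_le_left _ _)
  have hcκ : c ≤ κ / 2 := (min_le_left _ _).trans (min_le_right _ _)
  have hcl : c ≤ Real.log 2 / (C * K') := min_le_right _ _
  rcases Nat.eq_zero_or_pos N with hN | hN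
  · subst hN
    have : min ((0 : ℕ) * ε ^ 2) (((0 : ℕ) * ε) ^ α) = 0 := by
      simp [Real.zero_rpow hα.ne']
    rw [this]
    simp
  have hN' : (0 : ℝ) < N := by exact_mod_cast hN
  set t : ℝ := N * ε with ht
  have ht0 : 0 < t := by positivity
  have hNε : N * ε ^ 2 = t ^ 2 / N := by rw [ht]; field_simp
  rw [hNε]
  set M := min (t ^ 2 / N) (t ^ α) with hM
  -- In the first case half of the tail exponent pays for the union bound over the events that some
  -- variable exceeds `t`. In the second, `t ^ 2 / N ≤ C * K'`, and `c ≤ log 2 / (C * K')` makes the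
  -- claimed bound at least `1`.
  rcases le_or_gt (N * K') (Real.exp (κ / 2 * t ^ α)) with hcase | hcase
  · have hsub : {ω | t ≤ ∑ i, ξ i ω} ⊆
        {ω | t ≤ ∑ i, if ξ i ω ≤ t then ξ i ω else 0} ∪ ⋃ i, {ω | t ≤ ξ i ω} := by
      intro ω hω
      by_cases h : ∀ i, ξ i ω ≤ t
      · left
        simpa [h] using hω
      · right
        push Not at h
        obtain ⟨i, hi⟩ := h
        exact Set.mem_iUnion.2 ⟨i, hi.le⟩
    have hmark : ∀ i, μ.real {ω | t ≤ ξ i ω} ≤ K' * Real.exp (-(κ * t ^ α)) := by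
      intro i
      have h1 := mul_meas_ge_le_integral_of_nonneg (μ := μ)
        (f := fun ω => Real.exp (κ * |ξ i ω| ^ α)) (ae_of_all _ fun ω => (Real.exp_pos _).le)
        (hexp i) (Real.exp (κ * t ^ α))
      have h2 : μ.real {ω | t ≤ ξ i ω} ≤
          μ.real {ω | Real.exp (κ * t ^ α) ≤ Real.exp (κ * |ξ i ω| ^ α)} := by
        refine measureReal_mono fun ω hω => ?_
        have hω' : t ≤ |ξ i ω| := le_trans hω (le_abs_self _)
        simp only [Set.mem_ofPred_eq, Real.exp_le_exp]
        gcongr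
      have h3 : Real.exp (κ * t ^ α) * μ.real {ω | t ≤ ξ i ω} ≤ K' :=
        ((mul_le_mul_of_nonneg_left h2 (Real.exp_pos _).le).trans h1).trans
          ((hK i).trans (le_max_left _ _))
      rw [Real.exp_neg, ← div_eq_mul_inv, le_div_iff₀ (Real.exp_pos _), mul_comm]
      exact h3
    have hunion : μ.real (⋃ i, {ω | t ≤ ξ i ω}) ≤ Real.exp (-c * M) := by
      calc μ.real (⋃ i, {ω | t ≤ ξ i ω}) ≤ ∑ i, μ.real {ω | t ≤ ξ i ω} :=
            measureReal_iUnion_fintype_le _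
        _ ≤ ∑ _i : Fin N, K' * Real.exp (-(κ * t ^ α)) := Finset.sum_le_sum fun i _ => hmark i
        _ = N * K' * Real.exp (-(κ * t ^ α)) := by simp [mul_assoc]
        _ ≤ Real.exp (κ / 2 * t ^ α) * Real.exp (-(κ * t ^ α)) := by gcongr
        _ = Real.exp (-(κ / 2 * t ^ α)) := by rw [← Real.exp_add]; congr 1; ring
        _ ≤ _ := by
          rw [Real.exp_le_exp, neg_mul, neg_le_neg_iff]
          have : M ≤ t ^ α := min_le_right _ _
          gcongr
    have htr : μ.real {ω | t ≤ ∑ i, if ξ i ω ≤ t then ξ i ω else 0} ≤ Real.exp (-c * M) := by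
      refine (measureReal_truncation_sum_ge_le hα hα1 hm hind hint h0 hexp
        (fun i => (hK i).trans (le_max_left K 1)) hC hC0.le ha0.le (min_le_left _ _) haC
        ht0 hN).trans ?_
      rw [Real.exp_le_exp, neg_mul, neg_mul, neg_le_neg_iff]
      have : 0 ≤ M := le_min (by positivity) (by positivity)
      gcongr
    calc μ.real {ω | t ≤ ∑ i, ξ i ω} ≤ _ := measureReal_mono hsub
      _ ≤ _ := measureReal_union_le _ _
      _ ≤ _ := by linarith
  · have h1 : t ^ 2 / N ≤ C * K' := by
      rw [div_le_iff₀ hN']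
      calc t ^ 2 ≤ C * Real.exp (κ / 2 * t ^ α) := hC t ht0.le
        _ ≤ C * (N * K') := by gcongr
        _ = _ := by ring
    have h2 : c * M ≤ Real.log 2 := by
      calc c * M ≤ Real.log 2 / (C * K') * (C * K') := by
            gcongr; exact (min_le_left _ _).trans h1
        _ = _ := by field_simp
    have h3 : 1 ≤ 2 * Real.exp (-c * M) := by
      calc (1 : ℝ) = 2 * Real.exp (-Real.log 2) := by
            rw [Real.exp_neg, Real.exp_log (by norm_num)]; norm_num
        _ ≤ _ := by gcongr; linarith
    exact measureReal_le_one.trans h3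

/-! ### Weighted averages of functions of Gaussian variables -/

lemma integrable_exp_sq_div_four_gaussianReal :
    Integrable (fun x : ℝ => Real.exp (x ^ 2 / 4)) (gaussianReal 0 1) := by
  rw [gaussianReal_of_var_ne_zero 0 one_ne_zero,
    integrable_withDensity_iff_integrable_smul' (measurable_gaussianPDF 0 1)
      (ae_of_all _ fun x => gaussianPDF_lt_top)]
  have h := (integrable_exp_neg_mul_sq (b := 1 / 4) (by norm_num)).const_mul
    ((Real.sqrt (2 * Real.pi * (1 : ℝ≥0)))⁻¹)
  refine h.congr (ae_of_all _ fun x => ?_)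
  simp only [toReal_gaussianPDF, gaussianPDFReal, smul_eq_mul]
  rw [mul_assoc (√_)⁻¹, ← Real.exp_add]
  congr 2
  simp only [NNReal.coe_one]
  ring

lemma integrable_comp_of_map_eq {Ω : Type*} [MeasurableSpace Ω] {μ : Measure Ω} {ν : Measure ℝ}
    {G : Ω → ℝ} {f : ℝ → ℝ} (hG : Measurable G) (hlaw : μ.map G = ν) (hf : Measurable f)
    (hi : Integrable f ν) : Integrable (fun ω => f (G ω)) μ := by
  rw [← hlaw] at hi
  exact (integrable_map_measure hf.aestronglyMeasurable hG.aemeasurable).1 hi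

lemma integral_comp_of_map_eq {Ω : Type*} [MeasurableSpace Ω] {μ : Measure Ω} {ν : Measure ℝ}
    {G : Ω → ℝ} {f : ℝ → ℝ} (hG : Measurable G) (hlaw : μ.map G = ν) (hf : Measurable f) :
    ∫ ω, f (G ω) ∂μ = ∫ x, f x ∂ν := by
  rw [← hlaw, integral_map hG.aemeasurable hf.aestronglyMeasurable]

/-- The law is prescribed only where the weight is nonzero, because columns of scale zero cannot be
normalised to a standard Gaussian. -/
lemma integrable_weighted_sum {Ω : Type*} [MeasurableSpace Ω] {μ : Measure Ω} {ν : Measure ℝ}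
    {n : ℕ} {w : Fin n → ℝ} {G : Fin n → Ω → ℝ} {f : ℝ → ℝ} (hG : ∀ j, Measurable (G j))
    (hlaw : ∀ j, w j ≠ 0 → μ.map (G j) = ν) (hf : Measurable f) (hi : Integrable f ν) (j : Fin n) :
    Integrable (fun ω => w j * f (G j ω)) μ := by
  by_cases hj : w j = 0
  · simp [hj]
  · exact (integrable_comp_of_map_eq (hG j) (hlaw j hj) hf hi).const_mul _

lemma integral_weighted_sum {Ω : Type*} [MeasurableSpace Ω] {μ : Measure Ω} {ν : Measure ℝ}
    {n : ℕ} {w : Fin n → ℝ} {G : Fin n → Ω → ℝ} {f : ℝ → ℝ} (hw1 : ∑ j, w j = 1)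
    (hG : ∀ j, Measurable (G j))
    (hlaw : ∀ j, w j ≠ 0 → μ.map (G j) = ν) (hf : Measurable f) (hi : Integrable f ν) :
    ∫ ω, ∑ j, w j * f (G j ω) ∂μ = ∫ x, f x ∂ν := by
  rw [integral_finsetSum _ fun j _ => integrable_weighted_sum hG hlaw hf hi j]
  have : ∀ j, ∫ ω, w j * f (G j ω) ∂μ = w j * ∫ x, f x ∂ν := by
    intro j
    by_cases hj : w j = 0
    · simp [hj]
    · rw [integral_const_mul, integral_comp_of_map_eq (hG j) (hlaw j hj) hf]
  simp_rw [this]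
  rw [← Finset.sum_mul, hw1, one_mul]

lemma integrable_of_exp_rpow {ν : Measure ℝ} {q κ : ℝ} (hq : 0 < q) (hκ : 0 < κ) {f : ℝ → ℝ}
    (hf : Measurable f) (hi : Integrable (fun x => Real.exp (κ * |f x| ^ (1 / q))) ν) :
    Integrable f ν := by
  refine (hi.const_mul ((q / κ) ^ q)).mono' hf.aestronglyMeasurable (ae_of_all _ fun x => ?_)
  have h := rpow_le_exp_mul (s := q) (κ := κ) (u := |f x| ^ (1 / q)) hq hκ (by positivity)
  rwa [← Real.rpow_mul (abs_nonneg _), one_div, inv_mul_cancel₀ hq.ne', Real.rpow_one,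
    ← one_div] at h

/-- Subadditivity of `x ↦ x ^ (1 / q)` splits off the centring `m`; `exp_rpow_sum_le` handles the
average. -/
lemma exp_rpow_abs_weighted_sum_sub_le {n : ℕ} {q κ m : ℝ} (hq : 1 ≤ q) (hκ : 0 < κ)
    (w z : Fin n → ℝ) (hw : ∀ j, 0 ≤ w j) (hw1 : ∑ j, w j = 1) :
    Real.exp (κ * |∑ j, w j * z j - m| ^ (1 / q)) ≤
      Real.exp (κ * |m| ^ (1 / q)) *
        (Real.exp q + ∑ j, w j * Real.exp (κ * |z j| ^ (1 / q))) := by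
  have hq0 : 0 < q := by linarith
  have hq1 : 1 / q ≤ 1 := (div_le_one hq0).2 hq
  have h1 : |∑ j, w j * z j - m| ≤ ∑ j, w j * |z j| + |m| := by
    refine (abs_sub _ _).trans ?_
    gcongr
    refine (Finset.abs_sum_le_sum_abs _ _).trans (le_of_eq ?_)
    exact Finset.sum_congr rfl fun j _ => by rw [abs_mul, abs_of_nonneg (hw j)]
  have hs : 0 ≤ ∑ j, w j * |z j| := Finset.sum_nonneg fun j _ => mul_nonneg (hw j) (abs_nonneg _)
  have h2 : |∑ j, w j * z j - m| ^ (1 / q) ≤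
      (∑ j, w j * |z j|) ^ (1 / q) + |m| ^ (1 / q) :=
    (Real.rpow_le_rpow (abs_nonneg _) h1 (by positivity)).trans
      (Real.rpow_add_le_add_rpow hs (abs_nonneg _) (by positivity) hq1)
  calc _ ≤ Real.exp (κ * |m| ^ (1 / q) + κ * (∑ j, w j * |z j|) ^ (1 / q)) := by
        rw [Real.exp_le_exp, ← mul_add]
        gcongr
        linarith
    _ = Real.exp (κ * |m| ^ (1 / q)) * Real.exp (κ * (∑ j, w j * |z j|) ^ (1 / q)) :=
        Real.exp_add _ _
    _ ≤ _ := by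
        gcongr
        exact exp_rpow_sum_le hq0 hκ w (fun j => |z j|) hw hw1 fun j => abs_nonneg _

/-- Concentration of `∑ i, ∑ j, w j * f (G i j)` for independent rows `G i` of standard Gaussian
variables, arbitrarily correlated within a row, with constants independent of the weights. -/
theorem exists_measureReal_weighted_sum_ge_le.{u} (q S : ℝ) (hq : 1 ≤ q) (f : ℝ → ℝ)
    (hf : Measurable f) (hS : ∀ x, |f x| ≤ S * (1 + x ^ 2) ^ q) :
    ∃ c : ℝ, 0 < c ∧ ∀ (Ω : Type u) [MeasurableSpace Ω] (μ : Measure Ω) [IsProbabilityMeasure μ]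
      (N n : ℕ) (w : Fin n → ℝ) (G : Fin N → Fin n → Ω → ℝ), (∀ j, 0 ≤ w j) → ∑ j, w j = 1 →
      (∀ i j, Measurable (G i j)) →
      (∀ i j, w j ≠ 0 → μ.map (G i j) = gaussianReal 0 1) →
      iIndepFun (fun i ω j => G i j ω) μ →
      ∀ ε : ℝ, 0 < ε →
        μ.real {ω | N * ε ≤ ∑ i, (∑ j, w j * f (G i j ω) - ∫ x, f x ∂(gaussianReal 0 1))} ≤
          2 * Real.exp (-c * min (N * ε ^ 2) ((N * ε) ^ (1 / q))) := by
  have hq0 : 0 < q := by linarith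
  set S' := max S 1 with hS'
  have hS'0 : 0 < S' := lt_of_lt_of_le one_pos (le_max_right _ _)
  -- Chosen so that the exponent is at most `(1 + x ^ 2) / 4`, which the Gaussian density `exp (-x ^
  -- 2 / 2)` can absorb.
  set κ : ℝ := 1 / (4 * S' ^ (1 / q)) with hκdef
  have hκ : 0 < κ := by positivity
  set m := ∫ x, f x ∂(gaussianReal 0 1) with hmdef
  have hpt : ∀ x, κ * |f x| ^ (1 / q) ≤ 1 / 4 + x ^ 2 / 4 := by
    intro x
    have h1 : |f x| ≤ S' * (1 + x ^ 2) ^ q :=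
      (hS x).trans (by gcongr; exact le_max_left _ _)
    have h2 : |f x| ^ (1 / q) ≤ S' ^ (1 / q) * (1 + x ^ 2) := by
      calc |f x| ^ (1 / q) ≤ (S' * (1 + x ^ 2) ^ q) ^ (1 / q) := by gcongr
        _ = _ := by
          rw [Real.mul_rpow hS'0.le (by positivity), ← Real.rpow_mul (by positivity),
            mul_one_div_cancel hq0.ne', Real.rpow_one]
    calc κ * |f x| ^ (1 / q) ≤ κ * (S' ^ (1 / q) * (1 + x ^ 2)) := by gcongr
      _ = _ := by rw [hκdef]; field_simp
  have hem : Measurable fun x => Real.exp (κ * |f x| ^ (1 / q)) := by fun_prop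
  have hexp : Integrable (fun x => Real.exp (κ * |f x| ^ (1 / q))) (gaussianReal 0 1) := by
    refine (integrable_exp_sq_div_four_gaussianReal.const_mul (Real.exp (1 / 4))).mono'
      hem.aestronglyMeasurable (ae_of_all _ fun x => ?_)
    rw [Real.norm_of_nonneg (Real.exp_pos _).le, ← Real.exp_add]
    exact Real.exp_le_exp.2 (hpt x)
  have hfi : Integrable f (gaussianReal 0 1) := integrable_of_exp_rpow hq0 hκ hf hexp
  obtain ⟨c, hc, H⟩ := exists_measureReal_sum_ge_le.{u} (1 / q) κ
    (Real.exp (κ * |m| ^ (1 / q)) *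
      (Real.exp q + ∫ x, Real.exp (κ * |f x| ^ (1 / q)) ∂(gaussianReal 0 1)))
    (by positivity) ((div_le_one hq0).2 hq) hκ
  refine ⟨c, hc, ?_⟩
  intro Ω _ μ _ N n w G hw hw1 hG hlaw hind ε hε
  have hsum : ∀ i, Integrable (fun ω => ∑ j, w j * f (G i j ω)) μ := fun i =>
    integrable_finsetSum _ fun j _ => integrable_weighted_sum (hG i) (hlaw i) hf hfi j
  have hsume : ∀ i, Integrable
      (fun ω => ∑ j, w j * Real.exp (κ * |f (G i j ω)| ^ (1 / q))) μ := fun i =>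
    integrable_finsetSum _ fun j _ => integrable_weighted_sum (hG i) (hlaw i) hem hexp j
  have hdom : ∀ i, Integrable (fun ω => Real.exp (κ * |m| ^ (1 / q)) *
      (Real.exp q + ∑ j, w j * Real.exp (κ * |f (G i j ω)| ^ (1 / q)))) μ := fun i =>
    ((integrable_const _).add (hsume i)).const_mul _
  have hmeas : ∀ i, Measurable fun ω => ∑ j, w j * f (G i j ω) - m := fun i =>
    (Finset.measurable_sum _ fun j _ => (hf.comp (hG i j)).const_mul _).sub_const m
  have hle := fun i ω => exp_rpow_abs_weighted_sum_sub_le (m := m) hq hκ w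
    (fun j => f (G i j ω)) hw hw1
  have hi : ∀ i, Integrable
      (fun ω => Real.exp (κ * |∑ j, w j * f (G i j ω) - m| ^ (1 / q))) μ := by
    intro i
    have hm' := hmeas i
    refine (hdom i).mono' (Measurable.aestronglyMeasurable (by fun_prop)) (ae_of_all _ fun ω => ?_)
    rw [Real.norm_of_nonneg (Real.exp_pos _).le]
    exact hle i ω
  refine H Ω μ N (fun i ω => ∑ j, w j * f (G i j ω) - m) hmeas ?_
    (fun i => (hsum i).sub (integrable_const m)) ?_ hi ?_ ε hε
  · exact hind.comp (fun _ (v : Fin n → ℝ) => ∑ j, w j * f (v j) - m) fun i => by fun_prop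
  · intro i
    rw [integral_sub (hsum i) (integrable_const m),
      integral_weighted_sum hw1 (hG i) (hlaw i) hf hfi]
    simp [hmdef]
  · intro i
    refine (integral_mono (hi i) (hdom i) (hle i)).trans (le_of_eq ?_)
    rw [integral_const_mul, integral_add (integrable_const _) (hsume i),
      integral_weighted_sum hw1 (hG i) (hlaw i) hem hexp]
    simp

/-! ### Gaussian matrices -/

lemma map_sum_mul_div_eq_gaussianReal {Ω : Type*} [MeasurableSpace Ω] {μ : Measure Ω} [IsProbabilityMeasure μ]
    {d : ℕ} {g : Fin d → Ω → ℝ} (hm : ∀ k, Measurable (g k))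
    (hlaw : ∀ k, μ.map (g k) = gaussianReal 0 ((d : ℝ≥0)⁻¹)) (hind : iIndepFun g μ)
    (a : Fin d → ℝ) {r : ℝ} (hr : r ≠ 0) (hra : r ^ 2 = (∑ k, a k ^ 2) / d) :
    μ.map (fun ω => (∑ k, g k ω * a k) / r) = gaussianReal 0 1 := by
  have hL : ∀ k, HasLaw (g k) (gaussianReal 0 ((d : ℝ≥0)⁻¹)) μ :=
    fun k => ⟨(hm k).aemeasurable, hlaw k⟩
  set X : Fin d → Ω → ℝ := fun k ω => g k ω * (a k / r) with hX
  have hXL : ∀ k, HasLaw (X k) _ μ := fun k => gaussianReal_mul_const (hL k) (a k / r)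
  have hXg : ∀ k, HasGaussianLaw (X k) μ := fun k => (hXL k).hasGaussianLaw
  have hXind : iIndepFun X μ :=
    hind.comp (fun k x => x * (a k / r)) fun k => measurable_id.mul_const _
  have hsum := iIndepFun.hasGaussianLaw_sum hXg hXind
  have hEq : (fun ω => (∑ k, g k ω * a k) / r) = ∑ k, X k := by
    ext ω
    simp [hX, Finset.sum_div, mul_div_assoc]
  rw [hEq, hsum.map_eq_gaussianReal]
  have hmean : ∀ k, ∫ ω, X k ω ∂μ = 0 := by
    intro k
    rw [(hXL k).integral_eq]
    simp
  have hvar : ∀ k, Var[X k; μ] = (a k / r) ^ 2 * (d : ℝ)⁻¹ := by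
    intro k
    rw [(hXL k).variance_eq]
    simp
  have hM : ∫ ω, (∑ k, X k) ω ∂μ = 0 := by
    simp only [Finset.sum_apply]
    rw [integral_finsetSum _ fun k _ => (hXg k).memLp_two.integrable (by norm_num)]
    simp [hmean]
  have hV : Var[∑ k, X k; μ] = 1 := by
    rw [IndepFun.variance_sum (fun k _ => (hXg k).memLp_two)
      fun i _ j _ hij => hXind.indepFun hij]
    simp_rw [hvar, div_pow]
    rw [← Finset.sum_mul, ← Finset.sum_div, div_mul_eq_mul_div, ← div_eq_mul_inv, ← hra,
      div_self (pow_ne_zero 2 hr)]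
  rw [hM, hV]
  simp

/-- The entries are jointly Gaussian, so vanishing covariances between different rows give
independence of the rows. -/
lemma iIndepFun_rows {Ω : Type*} [MeasurableSpace Ω] {μ : Measure Ω}
    {N d : ℕ} {v : ℝ≥0} {W : Ω → Fin N → Fin d → ℝ} (hm : ∀ i k, Measurable fun ω => W ω i k)
    (hlaw : ∀ i k, μ.map (fun ω => W ω i k) = gaussianReal 0 v)
    (hind : iIndepFun (fun (x : Fin N × Fin d) ω => W ω x.1 x.2) μ) :
    iIndepFun (fun i ω => W ω i) μ := by
  have hL : ∀ x : Fin N × Fin d, HasGaussianLaw (fun ω => W ω x.1 x.2) μ := fun x =>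
    HasLaw.hasGaussianLaw (μ := gaussianReal 0 v) ⟨(hm x.1 x.2).aemeasurable, hlaw x.1 x.2⟩
  have hJ := iIndepFun.hasGaussianLaw hL hind
  have hJ' : HasGaussianLaw (fun ω i k => W ω i k) μ :=
    hJ.map (ContinuousLinearMap.pi fun i => ContinuousLinearMap.pi fun k =>
      ContinuousLinearMap.proj (R := ℝ) (φ := fun _ : Fin N × Fin d => ℝ) (i, k))
  refine HasGaussianLaw.iIndepFun_of_covariance_eval (X := fun i k ω => W ω i k) hJ' ?_
  intro i j hij k l
  have hne : (i, k) ≠ (j, l) := fun h => hij (congrArg Prod.fst h)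
  exact (hind.indepFun hne).covariance_eq_zero (hL (i, k)).memLp_two (hL (j, l)).memLp_two

/-! ### Positively homogeneous activations -/

lemma IsPosHomogeneous.apply_eq {p : ℝ} {σ : ℝ → ℝ} (hσ : IsPosHomogeneous p σ) (t : ℝ) :
    σ t = |t| ^ p * (if 0 ≤ t then σ 1 else σ (-1)) := by
  split_ifs with h
  · rw [← hσ |t| 1 (abs_nonneg t), abs_of_nonneg h, mul_one]
  · rw [← hσ |t| (-1) (abs_nonneg t), abs_of_neg (not_le.1 h)]
    simp

lemma IsPosHomogeneous.measurable {p : ℝ} {σ : ℝ → ℝ} (hσ : IsPosHomogeneous p σ) :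
    Measurable σ := by
  rw [funext hσ.apply_eq]
  exact (measurable_id.abs.pow_const p).mul
    (Measurable.ite measurableSet_Ici measurable_const measurable_const)

lemma IsPosHomogeneous.abs_le {p : ℝ} {σ : ℝ → ℝ} (hσ : IsPosHomogeneous p σ) (t : ℝ) :
    |σ t| ≤ (|σ 1| + |σ (-1)|) * |t| ^ p := by
  rw [hσ.apply_eq t, abs_mul, abs_of_nonneg (by positivity : 0 ≤ |t| ^ p), mul_comm]
  gcongr
  split_ifs <;> linarith [abs_nonneg (σ 1), abs_nonneg (σ (-1))]

lemma abs_rpow_le_one_add_sq_rpow {p q x : ℝ} (hp : 0 ≤ p) (hpq : p / 2 ≤ q) :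
    |x| ^ p ≤ (1 + x ^ 2) ^ q := by
  calc |x| ^ p = (x ^ 2) ^ (p / 2) := by
        rw [← sq_abs, ← Real.rpow_two, ← Real.rpow_mul (abs_nonneg x)]
        congr 1; ring
    _ ≤ (1 + x ^ 2) ^ (p / 2) := by gcongr; linarith
    _ ≤ (1 + x ^ 2) ^ q := Real.rpow_le_rpow_of_exponent_le (by nlinarith [sq_nonneg x]) hpq

lemma IsPosHomogeneous.sq_abs_le {p : ℝ} {σ : ℝ → ℝ} (hp : 0 ≤ p) (hσ : IsPosHomogeneous p σ)
    (x : ℝ) : σ x ^ 2 ≤ (|σ 1| + |σ (-1)|) ^ 2 * (1 + x ^ 2) ^ p := by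
  have h := hσ.abs_le x
  calc σ x ^ 2 = |σ x| ^ 2 := (sq_abs _).symm
    _ ≤ ((|σ 1| + |σ (-1)|) * |x| ^ p) ^ 2 := by gcongr
    _ = (|σ 1| + |σ (-1)|) ^ 2 * |x| ^ (2 * p) := by
        rw [mul_pow, ← Real.rpow_two (|x| ^ p), ← Real.rpow_mul (abs_nonneg x), mul_comm p 2]
    _ ≤ _ := by
        gcongr
        exact abs_rpow_le_one_add_sq_rpow (by linarith) (by linarith)

/-! ### One layer with a fixed input -/

/-- The `p`-th powers of the standard deviations of the entries of `W * a` in each column, for a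
Gaussian matrix `W` with entries of variance `1 / d`. -/
noncomputable def colScale (p : ℝ) {d n : ℕ} (a : Fin d → Fin n → ℝ) (j : Fin n) : ℝ :=
  Real.sqrt ((∑ k, a k j ^ 2) / d) ^ p

/-- The output `σ(V a)` of a layer has squared Frobenius norm at most `1 + ε₁` times its expectation,
and its pairing with `1 ⊗ colScale p a` is at least `1 - ε₂` times its expectation. -/
def IsGoodLayer (σ : ℝ → ℝ) (p s m₁ m₂ ε₁ ε₂ : ℝ) {N d n : ℕ} (V : Fin N → Fin d → ℝ)
    (a : Fin d → Fin n → ℝ) : Prop :=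
  (∑ i, ∑ j, σ (∑ k, V i k * a k j) ^ 2 ≤ (1 + ε₁) * (N * m₂ * ∑ j, colScale p a j ^ 2)) ∧
    (1 - ε₂) * (N * m₁ * ∑ j, colScale p a j ^ 2) ≤
      s * ∑ i, ∑ j, colScale p a j * σ (∑ k, V i k * a k j)

/-- Homogeneity pulls the standard deviation out of `σ`. If it is zero, then the column vanishes or
`d = 0`; the sum is zero and `σ 0 = 0` closes the case. -/
lemma apply_sum_eq_colScale_mul {p : ℝ} {σ : ℝ → ℝ} (hσ : IsPosHomogeneous p σ)
    (h0 : σ 0 = 0) {d n : ℕ} (v : Fin d → ℝ) (a : Fin d → Fin n → ℝ) (j : Fin n) :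
    σ (∑ k, v k * a k j) = colScale p a j *
      σ ((∑ k, v k * a k j) / Real.sqrt ((∑ k, a k j ^ 2) / d)) := by
  rw [colScale, ← hσ _ _ (Real.sqrt_nonneg _)]
  by_cases hr : Real.sqrt ((∑ k, a k j ^ 2) / d) = 0
  · rw [hr, zero_mul, h0]
    have hz : ∑ k, v k * a k j = 0 := by
      have hnn : 0 ≤ ∑ k, a k j ^ 2 := Finset.sum_nonneg fun k _ => sq_nonneg _
      rw [Real.sqrt_eq_zero (by positivity), div_eq_zero_iff] at hr
      rcases hr with hr | hr
      · rw [Finset.sum_eq_zero_iff_of_nonneg fun k _ => sq_nonneg _] at hr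
        exact Finset.sum_eq_zero fun k hk => by
          rw [pow_eq_zero_iff two_ne_zero |>.1 (hr k hk), mul_zero]
      · have : d = 0 := by exact_mod_cast hr
        subst this
        simp
    rw [hz, h0]
  · rw [mul_div_cancel₀ _ hr]

lemma min_rpow_le_min_rpow {p N ε : ℝ} (hp : 1 ≤ p) (hN : 0 ≤ N) (hε : 0 < ε) (hε1 : ε ≤ 1) :
    min (N * ε ^ 2) (N ^ min 1 (2 / p) * ε ^ (2 / p)) ≤
      min (N * ε ^ 2) ((N * ε) ^ (1 / max (p / 2) 1)) := by
  have hp0 : 0 < p := by linarith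
  refine le_min (min_le_left _ _) ?_
  rcases le_total p 2 with h | h
  · rw [max_eq_right (by linarith), div_one, Real.rpow_one]
    refine (min_le_left _ _).trans ?_
    gcongr
    nlinarith
  · refine (min_le_right _ _).trans (le_of_eq ?_)
    rw [max_eq_left (by linarith), min_eq_right ((div_le_one hp0).2 h),
      Real.mul_rpow hN hε.le, one_div_div]

/-- Two applications of the weighted concentration bound with the same weights: to `σ ^ 2 / m₂` with
`q = p` for the upper deviation, and to `-(s * σ / m₁)` with `q = max (p / 2) 1` for the lower one.
Normalising by the means makes both deviations relative. -/
theorem exists_measureReal_not_isGoodLayer_le.{u} (p : ℝ) (hp : 1 ≤ p) (σ : ℝ → ℝ)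
    (hσ : IsPosHomogeneous p σ) (h0 : σ 0 = 0) (s m₁ : ℝ)
    (hm₁ : 0 < m₁) (hs : s * ∫ t, σ t ∂(gaussianReal 0 1) = m₁)
    (hm₂ : 0 < ∫ t, σ t ^ 2 ∂(gaussianReal 0 1)) :
    ∃ c : ℝ, 0 < c ∧ ∀ (Ω : Type u) [MeasurableSpace Ω] (μ : Measure Ω) [IsProbabilityMeasure μ]
      (N d n : ℕ) (V : Ω → Fin N → Fin d → ℝ) (a : Fin d → Fin n → ℝ),
      (∀ i k, Measurable fun ω => V ω i k) →
      (∀ i k, μ.map (fun ω => V ω i k) = gaussianReal 0 ((d : ℝ≥0)⁻¹)) →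
      iIndepFun (fun (x : Fin N × Fin d) ω => V ω x.1 x.2) μ →
      ∀ ε₁ ε₂ : ℝ, 0 < ε₁ → 0 < ε₂ → ε₂ ≤ 1 →
        μ.real {ω | ¬ IsGoodLayer σ p s m₁ (∫ t, σ t ^ 2 ∂(gaussianReal 0 1)) ε₁ ε₂ (V ω) a} ≤
          2 * Real.exp (-c * min (N * ε₂ ^ 2) ((N : ℝ) ^ min 1 (2 / p) * ε₂ ^ (2 / p)))
            + 2 * Real.exp (-c * min (N * ε₁ ^ 2) ((N : ℝ) ^ min 1 (1 / p) * ε₁ ^ (1 / p))) := by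
  have hp0 : 0 < p := by linarith
  set m₂ := ∫ t, σ t ^ 2 ∂(gaussianReal 0 1) with hm₂def
  set B := |σ 1| + |σ (-1)| with hB
  have hσm := hσ.measurable
  obtain ⟨c₁, hc₁, H₁⟩ := exists_measureReal_weighted_sum_ge_le.{u} p (B ^ 2 / m₂) hp
    (fun x => σ x ^ 2 / m₂) (by fun_prop) (by
      intro x
      rw [abs_of_nonneg (by positivity), div_mul_eq_mul_div]
      gcongr
      exact hσ.sq_abs_le hp0.le x)
  obtain ⟨c₂, hc₂, H₂⟩ := exists_measureReal_weighted_sum_ge_le.{u} (max (p / 2) 1)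
    (|s| * B / m₁) (le_max_right _ _) (fun x => -(s * σ x / m₁)) (by fun_prop) (by
      intro x
      rw [abs_neg, abs_div, abs_mul, abs_of_pos hm₁, div_mul_eq_mul_div, mul_assoc]
      gcongr
      exact (hσ.abs_le x).trans (by
        gcongr; exact abs_rpow_le_one_add_sq_rpow hp0.le (le_max_left _ _)))
  refine ⟨min c₁ c₂, lt_min hc₁ hc₂, ?_⟩
  intro Ω _ μ _ N d n V a hVm hVlaw hVind ε₁ ε₂ hε₁ hε₂ hε₂1
  set T := ∑ j, colScale p a j ^ 2 with hT
  have hT0 : 0 ≤ T := Finset.sum_nonneg fun j _ => sq_nonneg _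
  rcases hT0.eq_or_lt with hTz | hTpos
  · have hu : ∀ j, colScale p a j = 0 := fun j => by
      have := (Finset.sum_eq_zero_iff_of_nonneg fun j _ => sq_nonneg (colScale p a j)).1
        hTz.symm j (Finset.mem_univ j)
      exact pow_eq_zero_iff two_ne_zero |>.1 this
    have hgood : {ω | ¬ IsGoodLayer σ p s m₁ m₂ ε₁ ε₂ (V ω) a} = ∅ := by
      ext ω
      simp only [Set.mem_ofPred_eq, Set.mem_empty_iff_false, iff_false, not_not]
      simp [IsGoodLayer, apply_sum_eq_colScale_mul hσ h0, hu]
    rw [hgood, measureReal_empty]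
    positivity
  set r : Fin n → ℝ := fun j => Real.sqrt ((∑ k, a k j ^ 2) / d) with hr
  set G : Fin N → Fin n → Ω → ℝ := fun i j ω => (∑ k, V ω i k * a k j) / r j with hG
  set w : Fin n → ℝ := fun j => colScale p a j ^ 2 / T with hw
  have hw0 : ∀ j, 0 ≤ w j := fun j => by positivity
  have hw1 : ∑ j, w j = 1 := by rw [← Finset.sum_div, ← hT, div_self hTpos.ne']
  have hGm : ∀ i j, Measurable (G i j) := fun i j => by fun_prop
  have hrow : ∀ i, iIndepFun (fun k ω => V ω i k) μ := fun i =>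
    hVind.precomp (g := fun k => (i, k)) fun k l h => congrArg Prod.snd h
  -- If `r j = 0`, the quotient `G i j` takes the default value `0`, but then `w j = 0` as well.
  have hGlaw : ∀ i j, w j ≠ 0 → μ.map (G i j) = gaussianReal 0 1 := by
    intro i j hj
    have hrj : r j ≠ 0 := by
      intro h
      apply hj
      simp only [hw, colScale]
      rw [show Real.sqrt ((∑ k, a k j ^ 2) / d) = 0 from h, Real.zero_rpow hp0.ne']
      simp
    exact map_sum_mul_div_eq_gaussianReal (hVm i) (hVlaw i) (hrow i) (fun k => a k j) hrj
      (Real.sq_sqrt (div_nonneg (Finset.sum_nonneg fun k _ => sq_nonneg _) d.cast_nonneg))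
  have hGind : iIndepFun (fun i ω j => G i j ω) μ :=
    (iIndepFun_rows hVm hVlaw hVind).comp
      (fun _ (v : Fin d → ℝ) j => (∑ k, v k * a k j) / r j) fun i => by fun_prop
  have hσG : ∀ i j ω, σ (∑ k, V ω i k * a k j) = colScale p a j * σ (G i j ω) :=
    fun i j ω => apply_sum_eq_colScale_mul hσ h0 (V ω i) a j
  have hint₁ : ∫ x, σ x ^ 2 / m₂ ∂(gaussianReal 0 1) = 1 := by
    rw [integral_div, ← hm₂def, div_self hm₂.ne']
  have hint₂ : ∫ x, -(s * σ x / m₁) ∂(gaussianReal 0 1) = -1 := by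
    rw [integral_neg, integral_div, integral_const_mul, hs, div_self hm₁.ne']
  have b₁ := H₁ Ω μ N n w G hw0 hw1 hGm hGlaw hGind ε₁ hε₁
  have b₂ := H₂ Ω μ N n w G hw0 hw1 hGm hGlaw hGind ε₂ hε₂
  rw [hint₁] at b₁
  rw [hint₂] at b₂
  have hsum₁ : ∀ ω, ∑ i, (∑ j, w j * (σ (G i j ω) ^ 2 / m₂) - 1) =
      (∑ i, ∑ j, σ (∑ k, V ω i k * a k j) ^ 2) / (m₂ * T) - N := by
    intro ω
    rw [Finset.sum_sub_distrib, Finset.sum_div]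
    congr 1
    · refine Finset.sum_congr rfl fun i _ => ?_
      rw [Finset.sum_div]
      refine Finset.sum_congr rfl fun j _ => ?_
      rw [hσG, hw]
      field_simp
    · simp
  have hsum₂ : ∀ ω, ∑ i, (∑ j, w j * -(s * σ (G i j ω) / m₁) - -1) =
      N - (s * ∑ i, ∑ j, colScale p a j * σ (∑ k, V ω i k * a k j)) / (m₁ * T) := by
    intro ω
    have h1 : s * ∑ i, ∑ j, colScale p a j * σ (∑ k, V ω i k * a k j) =
        -(m₁ * T) * ∑ i, ∑ j, w j * -(s * σ (G i j ω) / m₁) := by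
      rw [Finset.mul_sum, Finset.mul_sum]
      refine Finset.sum_congr rfl fun i _ => ?_
      rw [Finset.mul_sum, Finset.mul_sum]
      refine Finset.sum_congr rfl fun j _ => ?_
      rw [hσG, hw]
      field_simp
    rw [h1, Finset.sum_sub_distrib]
    rw [neg_mul, neg_div, mul_div_cancel_left₀ _ (by positivity : m₁ * T ≠ 0), sub_neg_eq_add,
      add_comm (N : ℝ)]
    generalize ∑ i, ∑ j, w j * -(s * σ (G i j ω) / m₁) = Y
    simp
  simp only [hsum₁] at b₁
  simp only [hsum₂] at b₂
  have hsub : {ω | ¬ IsGoodLayer σ p s m₁ m₂ ε₁ ε₂ (V ω) a} ⊆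
      {ω | N * ε₂ ≤ N - (s * ∑ i, ∑ j, colScale p a j * σ (∑ k, V ω i k * a k j)) / (m₁ * T)} ∪
      {ω | N * ε₁ ≤ (∑ i, ∑ j, σ (∑ k, V ω i k * a k j) ^ 2) / (m₂ * T) - N} := by
    intro ω hω
    simp only [Set.mem_ofPred_eq, IsGoodLayer, not_and_or, not_le, ← hT] at hω
    rcases hω with hω | hω
    · right
      simp only [Set.mem_ofPred_eq]
      rw [le_sub_iff_add_le, le_div_iff₀ (by positivity)]
      nlinarith
    · left
      simp only [Set.mem_ofPred_eq]
      rw [le_sub_comm, div_le_iff₀ (by positivity)]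
      nlinarith
  refine (measureReal_mono hsub).trans ((measureReal_union_le _ _).trans ?_)
  have hN : (0 : ℝ) ≤ N := N.cast_nonneg
  refine add_le_add (b₂.trans ?_) (b₁.trans ?_)
  · have h := min_rpow_le_min_rpow hp hN hε₂ hε₂1
    have h' : 0 ≤ min (N * ε₂ ^ 2) ((N : ℝ) ^ min 1 (2 / p) * ε₂ ^ (2 / p)) :=
      le_min (by positivity) (by positivity)
    rw [neg_mul, neg_mul]
    gcongr
    exact min_le_right _ _
  · have h' : 0 ≤ min (N * ε₁ ^ 2) ((N : ℝ) ^ (1 / p) * ε₁ ^ (1 / p)) :=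
      le_min (by positivity) (by positivity)
    rw [min_eq_right ((div_le_one hp0).2 hp), Real.mul_rpow hN hε₁.le, neg_mul, neg_mul]
    gcongr
    exact min_le_left _ _

/-! ### Stable rank of the output of a good layer -/

lemma frobNorm_sq {m n : ℕ} (A : Matrix (Fin m) (Fin n) ℝ) :
    frobNorm A ^ 2 = ∑ i, ∑ j, A i j ^ 2 := by
  have hnn : 0 ≤ ∑ i, ∑ j, A i j ^ 2 :=
    Finset.sum_nonneg fun i _ => Finset.sum_nonneg fun j _ => sq_nonneg _
  rw [frobNorm, Matrix.frobenius_norm_def]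
  simp only [Real.rpow_two, Real.norm_eq_abs, sq_abs]
  rw [← Real.sqrt_eq_rpow, Real.sq_sqrt hnn]

/-- Test `A` on `u` and apply Cauchy–Schwarz against the all-ones vector. -/
lemma sum_mul_sq_le_opNorm {m n : ℕ} (A : Matrix (Fin m) (Fin n) ℝ) (u : Fin n → ℝ) :
    (∑ i, ∑ j, u j * A i j) ^ 2 ≤ m * (opNorm A ^ 2 * ∑ j, u j ^ 2) := by
  have h1 : ‖WithLp.toLp 2 (A.mulVec u)‖ ≤ opNorm A * ‖WithLp.toLp 2 u‖ :=
    Matrix.l2_opNorm_mulVec A (WithLp.toLp 2 u)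
  have h2 : ‖WithLp.toLp 2 (A.mulVec u)‖ ^ 2 ≤ (opNorm A * ‖WithLp.toLp 2 u‖) ^ 2 := by gcongr
  rw [mul_pow, EuclideanSpace.norm_sq_eq, EuclideanSpace.norm_sq_eq] at h2
  simp only [Real.norm_eq_abs, sq_abs] at h2
  have h3 : ∀ i, ∑ j, u j * A i j = A.mulVec u i := fun i => by
    simp [Matrix.mulVec, dotProduct, mul_comm]
  simp_rw [h3]
  calc (∑ i, A.mulVec u i) ^ 2 ≤ (Finset.univ : Finset (Fin m)).card * ∑ i, A.mulVec u i ^ 2 :=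
        sq_sum_le_card_mul_sum_sq
    _ ≤ _ := by
        rw [Finset.card_univ, Fintype.card_fin]
        gcongr

lemma sum_colScale_sq_pos {p : ℝ} {d n : ℕ} {a : Matrix (Fin d) (Fin n) ℝ} (ha : a ≠ 0) :
    0 < ∑ j, colScale p a j ^ 2 := by
  obtain ⟨k, j, hkj⟩ : ∃ k j, a k j ≠ 0 := by
    by_contra! h
    exact ha (Matrix.ext h)
  have hd : (0 : ℝ) < d := by exact_mod_cast k.pos
  have h1 : 0 < ∑ k, a k j ^ 2 :=
    Finset.sum_pos' (fun k _ => sq_nonneg _) ⟨k, Finset.mem_univ k, by positivity⟩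
  have h2 : 0 < colScale p a j := Real.rpow_pos_of_pos (Real.sqrt_pos.2 (by positivity)) _
  exact Finset.sum_pos' (fun j _ => sq_nonneg _) ⟨j, Finset.mem_univ j, by positivity⟩

lemma stableRank_zero {m n : ℕ} : stableRank (0 : Matrix (Fin m) (Fin n) ℝ) = 0 := by
  simp [stableRank, frobNorm_sq]

lemma IsGoodLayer.stableRank_le {σ : ℝ → ℝ} {p s m₁ m₂ ε₁ ε₂ : ℝ} {N d n : ℕ}
    {V : Matrix (Fin N) (Fin d) ℝ} {a : Matrix (Fin d) (Fin n) ℝ}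
    (h : IsGoodLayer σ p s m₁ m₂ ε₁ ε₂ V a) (hs : s ^ 2 = 1) (hm₁ : 0 < m₁) (hm₂ : 0 ≤ m₂)
    (hε₁ : 0 < ε₁) (hε₂ : ε₂ < 1) (hN : 0 < N) (ha : a ≠ 0) :
    (V * a).map σ ≠ 0 ∧
      stableRank ((V * a).map σ) ≤ (1 + ε₁) / (1 - ε₂) ^ 2 * (m₂ / m₁ ^ 2) := by
  obtain ⟨hF, hO⟩ := h
  set A := (V * a).map σ with hA
  have hAij : ∀ i j, A i j = σ (∑ k, V i k * a k j) := fun i j => by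
    simp [hA, Matrix.mul_apply]
  set T := ∑ j, colScale p a j ^ 2 with hT
  have hTpos : 0 < T := sum_colScale_sq_pos ha
  have hN' : (0 : ℝ) < N := by exact_mod_cast hN
  have h1ε : 0 < 1 - ε₂ := by linarith
  simp_rw [← hAij] at hF hO
  rw [← frobNorm_sq] at hF
  have hop := sum_mul_sq_le_opNorm A (colScale p a)
  have hsq : ((1 - ε₂) * (N * m₁ * T)) ^ 2 ≤ N * (opNorm A ^ 2 * T) := by
    calc ((1 - ε₂) * (N * m₁ * T)) ^ 2 ≤ (s * ∑ i, ∑ j, colScale p a j * A i j) ^ 2 := by gcongr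
      _ = (∑ i, ∑ j, colScale p a j * A i j) ^ 2 := by rw [mul_pow, hs, one_mul]
      _ ≤ _ := hop
  have hlow : (1 - ε₂) ^ 2 * (N * m₁ ^ 2 * T) ≤ opNorm A ^ 2 := by
    have hNT : 0 < N * T := by positivity
    refine le_of_mul_le_mul_left ?_ hNT
    calc _ = ((1 - ε₂) * (N * m₁ * T)) ^ 2 := by ring
      _ ≤ _ := hsq
      _ = _ := by ring
  have hlowpos : 0 < (1 - ε₂) ^ 2 * (N * m₁ ^ 2 * T) := by positivity
  refine ⟨fun h => ?_, ?_⟩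
  · rw [h] at hlow
    have : opNorm (0 : Matrix (Fin N) (Fin n) ℝ) = 0 :=
      @norm_zero _ Matrix.instL2OpNormedAddCommGroup.toSeminormedAddCommGroup.toSeminormedAddGroup
    rw [this] at hlow
    linarith
  · calc stableRank A ≤ (1 + ε₁) * (N * m₂ * T) / ((1 - ε₂) ^ 2 * (N * m₁ ^ 2 * T)) := by
          rw [stableRank]; gcongr
      _ = _ := by field_simp

/-! ### The network -/

lemma postActivation_succ {L : ℕ} {d : Fin (L + 1) → ℕ} {n : ℕ} (σ : ℝ → ℝ)
    (W : (ℓ : Fin L) → Matrix (Fin (d ℓ.succ)) (Fin (d ℓ.castSucc)) ℝ)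
    (X : Matrix (Fin (d 0)) (Fin n) ℝ) (ℓ : Fin L) :
    postActivation σ W X ℓ.succ = (W ℓ * postActivation σ W X ℓ.castSucc).map σ :=
  Fin.induction_succ _ _ _

/-- Only earlier weights enter an activation; this is what makes the input of a layer independent of
its weights. -/
lemma postActivation_congr {L : ℕ} {d : Fin (L + 1) → ℕ} {n : ℕ} (σ : ℝ → ℝ)
    {W W' : (ℓ : Fin L) → Matrix (Fin (d ℓ.succ)) (Fin (d ℓ.castSucc)) ℝ}
    (X : Matrix (Fin (d 0)) (Fin n) ℝ) (j : Fin (L + 1))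
    (h : ∀ k : Fin L, k.castSucc < j → W k = W' k) :
    postActivation σ W X j = postActivation σ W' X j := by
  induction j using Fin.induction with
  | zero => rfl
  | succ i ih =>
    rw [postActivation_succ, postActivation_succ, h i Fin.castSucc_lt_succ,
      ih fun k hk => h k (hk.trans Fin.castSucc_lt_succ)]

lemma measurable_postActivation {α : Type*} [MeasurableSpace α] {L : ℕ} {d : Fin (L + 1) → ℕ}
    {n : ℕ} {σ : ℝ → ℝ} (hσ : Measurable σ)
    {W : α → (ℓ : Fin L) → Matrix (Fin (d ℓ.succ)) (Fin (d ℓ.castSucc)) ℝ}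
    (hW : ∀ ℓ i k, Measurable fun x => W x ℓ i k)
    (X : Matrix (Fin (d 0)) (Fin n) ℝ) (j : Fin (L + 1)) :
    ∀ i k, Measurable fun x => postActivation σ (W x) X j i k := by
  induction j using Fin.induction with
  | zero => exact fun i k => measurable_const
  | succ l ih =>
    intro i k
    simp only [postActivation_succ, Matrix.map_apply, Matrix.mul_apply]
    exact hσ.comp (Finset.measurable_sum _ fun m _ => (hW l i m).mul (ih m k))

lemma postActivation_eq_zero {L : ℕ} {d : Fin (L + 1) → ℕ} {n : ℕ} {σ : ℝ → ℝ} (h0 : σ 0 = 0)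
    (W : (ℓ : Fin L) → Matrix (Fin (d ℓ.succ)) (Fin (d ℓ.castSucc)) ℝ) (j : Fin (L + 1)) :
    postActivation σ W (0 : Matrix (Fin (d 0)) (Fin n) ℝ) j = 0 := by
  induction j using Fin.induction with
  | zero => rfl
  | succ l ih =>
    rw [postActivation_succ, ih, Matrix.mul_zero]
    exact Matrix.map_zero _ h0

/-- The input of a layer is independent of its weights. -/
lemma IsGaussianInit.indepFun_postActivation {Ω : Type*} [MeasurableSpace Ω] {μ : Measure Ω}
    {L : ℕ} {d : Fin (L + 1) → ℕ} {n : ℕ} {σ : ℝ → ℝ} (hσ : Measurable σ)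
    {W : (ℓ : Fin L) → Ω → Matrix (Fin (d ℓ.succ)) (Fin (d ℓ.castSucc)) ℝ}
    (hW : IsGaussianInit μ W) (X : Matrix (Fin (d 0)) (Fin n) ℝ) (ℓ : Fin L) :
    IndepFun (fun ω i k => postActivation σ (fun m => W m ω) X ℓ.castSucc i k)
      (fun ω i k => W ℓ ω i k) μ := by
  classical
  set S : Finset ((ℓ : Fin L) × (Fin (d ℓ.succ) × Fin (d ℓ.castSucc))) :=
    Finset.univ.filter fun x => x.1 < ℓ with hS
  set T : Finset ((ℓ : Fin L) × (Fin (d ℓ.succ) × Fin (d ℓ.castSucc))) :=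
    Finset.univ.filter fun x => x.1 = ℓ with hT
  have hST : Disjoint S T := by
    rw [Finset.disjoint_left]
    intro x hx hx'
    simp only [hS, hT, Finset.mem_filter, Finset.mem_univ, true_and] at hx hx'
    exact hx.ne hx'
  have hmemT : ∀ i k, (⟨ℓ, (i, k)⟩ : (ℓ : Fin L) × (Fin (d ℓ.succ) × Fin (d ℓ.castSucc))) ∈ T :=
    fun i k => by simp [hT]
  have hind := hW.indep.indepFun_finset S T hST fun x => hW.measurable x.1 x.2.1 x.2.2
  -- Padding the later weights with zeros exhibits the activation as a measurable function of the
  -- earlier weights alone.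
  let extend : (S → ℝ) → (m : Fin L) → Matrix (Fin (d m.succ)) (Fin (d m.castSucc)) ℝ :=
    fun v m i k => if h : (⟨m, (i, k)⟩ : (ℓ : Fin L) × (Fin (d ℓ.succ) × Fin (d ℓ.castSucc))) ∈ S
      then v ⟨_, h⟩ else 0
  have hext : ∀ m i k, Measurable fun v => extend v m i k := by
    intro m i k
    by_cases h : (⟨m, (i, k)⟩ : (ℓ : Fin L) × (Fin (d ℓ.succ) × Fin (d ℓ.castSucc))) ∈ S
    · simp only [extend, h, dite_true]
      exact measurable_pi_apply _
    · simp only [extend, h, dite_false]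
      exact measurable_const
  have hcomp := hind.comp
    (φ := fun v i k => postActivation σ (extend v) X ℓ.castSucc i k)
    (ψ := fun v i k => v ⟨⟨ℓ, (i, k)⟩, hmemT i k⟩)
    (measurable_pi_lambda _ fun i => measurable_pi_lambda _ fun k =>
      measurable_postActivation hσ hext X ℓ.castSucc i k)
    (measurable_pi_lambda _ fun i => measurable_pi_lambda _ fun k => measurable_pi_apply _)
  convert hcomp using 1
  · ext ω i k
    simp only [Function.comp_apply]
    refine congrFun (congrFun (postActivation_congr σ X ℓ.castSucc fun m hm => ?_) i) k
    ext a b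
    have : (⟨m, (a, b)⟩ : (ℓ : Fin L) × (Fin (d ℓ.succ) × Fin (d ℓ.castSucc))) ∈ S := by
      simpa [hS] using hm
    simp only [extend, this, dite_true]
  · rfl

/-- Fubini: by independence the joint law is a product, so a bound uniform in the frozen value `a`
survives integration over it. -/
lemma measureReal_pair_mem_le {Ω α β : Type*} [MeasurableSpace Ω] [MeasurableSpace α]
    [MeasurableSpace β] {μ : Measure Ω} [IsProbabilityMeasure μ] {A : Ω → α} {V : Ω → β}
    (hind : IndepFun A V μ) (hA : Measurable A) (hV : Measurable V) {B : Set (α × β)}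
    (hB : MeasurableSet B) {b : ℝ} (h : ∀ a, μ.real {ω | (a, V ω) ∈ B} ≤ b) :
    μ.real {ω | (A ω, V ω) ∈ B} ≤ b := by
  have : IsProbabilityMeasure (μ.map A) := Measure.isProbabilityMeasure_map hA.aemeasurable
  have : IsProbabilityMeasure (μ.map V) := Measure.isProbabilityMeasure_map hV.aemeasurable
  have hb : 0 ≤ b := by
    obtain ⟨ω⟩ : Nonempty Ω := nonempty_of_isProbabilityMeasure μ
    exact measureReal_nonneg.trans (h (A ω))
  have h1 : μ {ω | (A ω, V ω) ∈ B} = ((μ.map A).prod (μ.map V)) B := by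
    rw [← hind.map_prod_eq_prod_map_map hA.aemeasurable hV.aemeasurable,
      Measure.map_apply (hA.prodMk hV) hB]
    rfl
  refine ENNReal.toReal_le_of_le_ofReal hb ?_
  rw [h1, Measure.prod_apply hB]
  calc ∫⁻ a, (μ.map V) (Prod.mk a ⁻¹' B) ∂(μ.map A) ≤ ∫⁻ _, ENNReal.ofReal b ∂(μ.map A) := by
        refine lintegral_mono fun a => ?_
        rw [Measure.map_apply hV (measurable_prodMk_left hB)]
        exact (ENNReal.le_ofReal_iff_toReal_le (measure_ne_top _ _) hb).2 (h a)
    _ = ENNReal.ofReal b := by simp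

lemma measurableSet_isGoodLayer {σ : ℝ → ℝ} (hσ : Measurable σ) (p s m₁ m₂ ε₁ ε₂ : ℝ)
    (N d n : ℕ) :
    MeasurableSet {x : (Fin d → Fin n → ℝ) × (Fin N → Fin d → ℝ) |
      ¬ IsGoodLayer σ p s m₁ m₂ ε₁ ε₂ x.2 x.1} := by
  have hc : ∀ j, Measurable fun x : (Fin d → Fin n → ℝ) × (Fin N → Fin d → ℝ) =>
      colScale p x.1 j := fun j => by
    unfold colScale
    fun_prop
  simp only [IsGoodLayer]
  exact ((measurableSet_le
      (f := fun x : (Fin d → Fin n → ℝ) × (Fin N → Fin d → ℝ) =>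
        ∑ i, ∑ j, σ (∑ k, x.2 i k * x.1 k j) ^ 2)
      (g := fun x => (1 + ε₁) * (N * m₂ * ∑ j, colScale p x.1 j ^ 2))
      (by fun_prop) (by fun_prop)).inter
    (measurableSet_le
      (f := fun x : (Fin d → Fin n → ℝ) × (Fin N → Fin d → ℝ) =>
        (1 - ε₂) * (N * m₁ * ∑ j, colScale p x.1 j ^ 2))
      (g := fun x => s * ∑ i, ∑ j, colScale p x.1 j * σ (∑ k, x.2 i k * x.1 k j))
      (by fun_prop) (by fun_prop))).compl

lemma sq_integral_le_integral_sq_gaussianReal {p : ℝ} (hp : 1 ≤ p) {σ : ℝ → ℝ}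
    (hσ : IsPosHomogeneous p σ) :
    (∫ t, σ t ∂(gaussianReal 0 1)) ^ 2 ≤ ∫ t, σ t ^ 2 ∂(gaussianReal 0 1) := by
  have hLp : MemLp σ 2 (gaussianReal 0 1) := by
    refine (memLp_two_iff_integrable_sq hσ.measurable.aestronglyMeasurable).2 ?_
    have hσm := hσ.measurable
    refine (integrable_exp_sq_div_four_gaussianReal.const_mul
      ((|σ 1| + |σ (-1)|) ^ 2 * ((p / (1 / 4)) ^ p * Real.exp (1 / 4)))).mono'
      (Measurable.aestronglyMeasurable (by fun_prop)) (ae_of_all _ fun x => ?_)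
    rw [Real.norm_of_nonneg (sq_nonneg _)]
    refine (hσ.sq_abs_le (by linarith) x).trans ?_
    rw [mul_assoc, mul_assoc]
    gcongr
    refine (rpow_le_exp_mul (s := p) (κ := 1 / 4) (by linarith) (by norm_num)
      (by positivity)).trans (le_of_eq ?_)
    rw [← Real.exp_add]
    congr 2
    ring
  have h := variance_nonneg σ (gaussianReal 0 1)
  rw [variance_eq_sub hLp] at h
  simp only [Pi.pow_apply] at h
  linarith

/-- The stable rank bound for one fixed activation. -/
theorem exists_stableRank_bound.{u} (p : ℝ) (hp : 1 ≤ p) (σ : ℝ → ℝ) (hσ : IsPosHomogeneous p σ)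
    (h0 : σ 0 = 0) (m₁ : ℝ) (hm₁ : 0 < m₁) (hmean : |∫ t, σ t ∂(gaussianReal 0 1)| = m₁) :
    ∃ c : ℝ, 0 < c ∧
      ∀ (ε₁ ε₂ : ℝ), 0 < ε₁ → 0 < ε₂ → ε₂ < 1 →
      ∀ (L : ℕ) (d : Fin (L + 1) → ℕ) (n : ℕ) (X : Matrix (Fin (d 0)) (Fin n) ℝ)
        (Ω : Type u) [MeasurableSpace Ω] (μ : Measure Ω) [IsProbabilityMeasure μ]
        (W : (ℓ : Fin L) → Ω → Matrix (Fin (d ℓ.succ)) (Fin (d ℓ.castSucc)) ℝ),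
        IsGaussianInit μ W →
        1 - ∑ ℓ : Fin L,
            (2 * Real.exp (-c * min ((d ℓ.succ : ℝ) * ε₂ ^ 2)
                ((d ℓ.succ : ℝ) ^ min 1 (2 / p) * ε₂ ^ (2 / p)))
              + 2 * Real.exp (-c * min ((d ℓ.succ : ℝ) * ε₁ ^ 2)
                ((d ℓ.succ : ℝ) ^ min 1 (1 / p) * ε₁ ^ (1 / p))))
          ≤ μ.real {ω | ∀ ℓ : Fin L,
              (X ≠ 0 → postActivation σ (fun k => W k ω) X ℓ.succ ≠ 0) ∧
              stableRank (postActivation σ (fun k => W k ω) X ℓ.succ)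
                ≤ (1 + ε₁) / (1 - ε₂) ^ 2 *
                  ((∫ t, σ t ^ 2 ∂(gaussianReal 0 1)) / m₁ ^ 2)} := by
  have hp0 : 0 < p := by linarith
  -- `s` is the sign of the mean; it disappears once the pairing is squared.
  obtain ⟨s, hs2, hs⟩ : ∃ s : ℝ, s ^ 2 = 1 ∧ s * ∫ t, σ t ∂(gaussianReal 0 1) = m₁ := by
    rcases abs_choice (∫ t, σ t ∂(gaussianReal 0 1)) with h | h
    · exact ⟨1, by norm_num, by rw [one_mul, ← hmean, h]⟩
    · exact ⟨-1, by norm_num, by rw [neg_one_mul, ← hmean, h]⟩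
  have hm₂ : 0 < ∫ t, σ t ^ 2 ∂(gaussianReal 0 1) := by
    refine lt_of_lt_of_le ?_ (sq_integral_le_integral_sq_gaussianReal hp hσ)
    rw [← sq_abs, hmean]
    positivity
  obtain ⟨c, hc, H⟩ := exists_measureReal_not_isGoodLayer_le.{u} p hp σ hσ h0 s m₁ hm₁ hs hm₂
  refine ⟨c, hc, ?_⟩
  intro ε₁ ε₂ hε₁ hε₂ hε₂1 L d n X Ω _ μ _ W hW
  set m₂ := ∫ t, σ t ^ 2 ∂(gaussianReal 0 1) with hm₂def
  set E := {ω | ∀ ℓ : Fin L, (X ≠ 0 → postActivation σ (fun k => W k ω) X ℓ.succ ≠ 0) ∧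
    stableRank (postActivation σ (fun k => W k ω) X ℓ.succ)
      ≤ (1 + ε₁) / (1 - ε₂) ^ 2 * (m₂ / m₁ ^ 2)} with hE
  set b : Fin L → ℝ := fun ℓ => 2 * Real.exp (-c * min ((d ℓ.succ : ℝ) * ε₂ ^ 2)
      ((d ℓ.succ : ℝ) ^ min 1 (2 / p) * ε₂ ^ (2 / p)))
    + 2 * Real.exp (-c * min ((d ℓ.succ : ℝ) * ε₁ ^ 2)
      ((d ℓ.succ : ℝ) ^ min 1 (1 / p) * ε₁ ^ (1 / p))) with hb
  have hb0 : ∀ ℓ, 0 ≤ b ℓ := fun ℓ => by positivity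
  change 1 - ∑ ℓ, b ℓ ≤ μ.real E
  -- A layer of width zero has a zero activation, but its failure term is `4`, so the claimed
  -- probability is negative.
  by_cases hd : ∃ ℓ : Fin L, d ℓ.succ = 0
  · obtain ⟨ℓ, hℓ⟩ := hd
    have h1 : 1 ≤ b ℓ := by
      have hmin : 0 < min 1 (2 / p) := by positivity
      have hmin' : 0 < min 1 (1 / p) := by positivity
      simp only [hb, hℓ, Nat.cast_zero, Real.zero_rpow hmin.ne', Real.zero_rpow hmin'.ne',
        zero_mul, min_self, mul_zero, Real.exp_zero]
      norm_num
    have h2 : b ℓ ≤ ∑ ℓ, b ℓ := Finset.single_le_sum (fun i _ => hb0 i) (Finset.mem_univ ℓ)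
    linarith [measureReal_nonneg (μ := μ) (s := E)]
  push Not at hd
  have hconst : 0 ≤ (1 + ε₁) / (1 - ε₂) ^ 2 * (m₂ / m₁ ^ 2) := by positivity
  set bad : Fin L → Set Ω := fun ℓ => {ω | ¬ IsGoodLayer σ p s m₁ m₂ ε₁ ε₂
    (fun i k => W ℓ ω i k)
    (fun i k => postActivation σ (fun k => W k ω) X ℓ.castSucc i k)} with hbad
  have hbound : ∀ ℓ, μ.real (bad ℓ) ≤ b ℓ := by
    intro ℓ
    refine measureReal_pair_mem_le (hW.indepFun_postActivation hσ.measurable X ℓ)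
      (measurable_pi_lambda _ fun i => measurable_pi_lambda _ fun k =>
        measurable_postActivation hσ.measurable (fun m => hW.measurable m) X _ i k)
      (measurable_pi_lambda _ fun i => measurable_pi_lambda _ fun k => hW.measurable ℓ i k)
      (measurableSet_isGoodLayer hσ.measurable p s m₁ m₂ ε₁ ε₂ _ _ _) fun a => ?_
    refine H Ω μ (d ℓ.succ) (d ℓ.castSucc) n (fun ω i k => W ℓ ω i k) a (hW.measurable ℓ)
      (hW.law ℓ) ?_ ε₁ ε₂ hε₁ hε₂ hε₂1.le
    exact hW.indep.precomp (g := fun x => ⟨ℓ, x⟩) fun x y h => by simpa using h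
  have hcover : Set.univ ⊆ E ∪ ⋃ ℓ, bad ℓ := by
    intro ω _
    by_cases hω : ∃ ℓ, ω ∈ bad ℓ
    · exact Or.inr (Set.mem_iUnion.2 hω)
    left
    push Not at hω
    have hgood : ∀ ℓ, IsGoodLayer σ p s m₁ m₂ ε₁ ε₂ (W ℓ ω)
        (postActivation σ (fun k => W k ω) X ℓ.castSucc) := fun ℓ => not_not.1 (hω ℓ)
    by_cases hX : X = 0
    · intro ℓ
      refine ⟨fun h => absurd hX h, ?_⟩
      rw [hX, postActivation_eq_zero h0, stableRank_zero]
      exact hconst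
    · have hne : ∀ j, postActivation σ (fun k => W k ω) X j ≠ 0 := by
        intro j
        induction j using Fin.induction with
        | zero => exact hX
        | succ i ih =>
          rw [postActivation_succ]
          exact ((hgood i).stableRank_le hs2 hm₁ hm₂.le hε₁ hε₂1
            (Nat.pos_of_ne_zero (hd i)) ih).1
      intro ℓ
      refine ⟨fun _ => hne _, ?_⟩
      rw [postActivation_succ]
      exact ((hgood ℓ).stableRank_le hs2 hm₁ hm₂.le hε₁ hε₂1
        (Nat.pos_of_ne_zero (hd ℓ)) (hne _)).2
  have hfin : 1 ≤ μ.real E + ∑ ℓ, b ℓ := by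
    calc (1 : ℝ) = μ.real Set.univ := by simp
      _ ≤ μ.real (E ∪ ⋃ ℓ, bad ℓ) := measureReal_mono hcover
      _ ≤ μ.real E + μ.real (⋃ ℓ, bad ℓ) := measureReal_union_le _ _
      _ ≤ μ.real E + ∑ ℓ, μ.real (bad ℓ) := by gcongr; exact measureReal_iUnion_fintype_le _
      _ ≤ _ := by gcongr with ℓ; exact hbound ℓ
  linarith

/-- The constant must precede `σ`. Since `p`, `σ 1` and `σ (-1)` determine `σ`, at most one
activation is compatible with the data: its constant serves, and if there is none any `c` does. -/
theorem mainTheorem2 (p : ℝ) (hp : 1 ≤ p) (s₁ s₂ m₁ : ℝ) (hm₁ : 0 < m₁) :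
    ∃ c : ℝ, 0 < c ∧
      ∀ (σ : ℝ → ℝ) (Lσ : ℝ), IsPosHomogeneous p σ → σ 0 = 0 → (∀ t, |σ t| ≤ Lσ * |t| ^ p) →
        σ 1 = s₁ → σ (-1) = s₂ → |∫ t, σ t ∂(gaussianReal 0 1)| = m₁ →
      ∀ (ε₁ ε₂ : ℝ), 0 < ε₁ → ε₁ ≤ 1 → 0 < ε₂ → ε₂ < 1 →
      ∀ (L : ℕ) (d : Fin (L + 1) → ℕ) (n : ℕ) (X : Matrix (Fin (d 0)) (Fin n) ℝ)
        (Ω : Type*) [MeasurableSpace Ω] (μ : Measure Ω) [IsProbabilityMeasure μ]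
        (W : (ℓ : Fin L) → Ω → Matrix (Fin (d ℓ.succ)) (Fin (d ℓ.castSucc)) ℝ),
        IsGaussianInit μ W →
        1 - ∑ ℓ : Fin L,
            (2 * Real.exp (-c * min ((d ℓ.succ : ℝ) * ε₂ ^ 2)
                ((d ℓ.succ : ℝ) ^ min 1 (2 / p) * ε₂ ^ (2 / p)))
              + 2 * Real.exp (-c * min ((d ℓ.succ : ℝ) * ε₁ ^ 2)
                ((d ℓ.succ : ℝ) ^ min 1 (1 / p) * ε₁ ^ (1 / p))))
          ≤ μ.real {ω | ∀ ℓ : Fin L,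
              (X ≠ 0 → postActivation σ (fun k => W k ω) X ℓ.succ ≠ 0) ∧
              stableRank (postActivation σ (fun k => W k ω) X ℓ.succ)
                ≤ (1 + ε₁) / (1 - ε₂) ^ 2 *
                  ((∫ t, σ t ^ 2 ∂(gaussianReal 0 1)) / m₁ ^ 2)} := by
  by_cases hex : ∃ σ : ℝ → ℝ, IsPosHomogeneous p σ ∧ σ 0 = 0 ∧ σ 1 = s₁ ∧ σ (-1) = s₂ ∧
      |∫ t, σ t ∂(gaussianReal 0 1)| = m₁
  · obtain ⟨σ₀, hσ₀, h0, h1, h2, hmean⟩ := hex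
    obtain ⟨c, hc, H⟩ := exists_stableRank_bound p hp σ₀ hσ₀ h0 m₁ hm₁ hmean
    refine ⟨c, hc, ?_⟩
    intro σ Lσ hσ _ _ hσ1 hσ2 _ ε₁ ε₂ hε₁ _ hε₂ hε₂1
    have hEq : σ = σ₀ := by
      ext t
      rw [hσ.apply_eq t, hσ₀.apply_eq t, hσ1, hσ2, h1, h2]
    rw [hEq]
    exact H ε₁ ε₂ hε₁ hε₂ hε₂1
  · refine ⟨1, one_pos, ?_⟩
    intro σ Lσ hσ h0 _ hσ1 hσ2 hmean
    exact absurd ⟨σ, hσ, h0, hσ1, hσ2, hmean⟩ hex
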